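/- **Definitions.** A *pre-Kleene algebra* is an idempotent semiring (ordered by $x\le y \iff x+y=y$) with a unary operation ${}^*$ satisfying only $x^*=1+x\,x^*$. A *commutable set* is a set $X$ with a reflexive symmetric relation $\sim$; $\mathcal T X$ is the free pre-Kleene algebra on $X$ subject to $xy=yx$ whenever $x\sim y$. For a discrete commutable set $X$ (that is, $\sim$ is equality), $\ddot X=\{x_l\mid x\in X\}\uplus\{y_r\mid y\in X\}$, where $x_l\sim y_r$ (and $y_r \sim x_l$) for all $x,y\in X$ and otherwise each symbol commutes only with itself. The maps $x\mapsto x_l$ and $x\mapsto x_r$ extend to morphisms $e\mapsto e_l$, $e\mapsto e_r$ from $\mathcal T X$ to $\mathcal T\ddot X$, and a term $e\in\mathcal TX$ is viewed as an element of $\mathcal T\ddot X$ through the morphism $x\mapsto x_lx_r$. A finite set of elements stands for its sum. For $e\in\mathcal T\ddot X$ and words $s,s'$ over $X$, write $s\to_e s'$ if $s_l s'_r\le e$, and $\to_e^*$ for the reflexive-transitive closure. A *two-counter machine* $M=(Q_M,\dot q,\iota)$ has a finite set $Q_M$ of states, an initial state $\dot q\in Q_M$, and a function $\iota$ assigning to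 each state an instruction $\mathrm{Inc}(r,q)$, $\mathrm{If}(r,q_1,q_2)$ or $\mathrm{Halt}(x)$, with $r\in\{1,2\}$, $q,q_1,q_2\in Q_M$, $x\in\{0,1\}$. Let $\Sigma_M=Q_M+\{a,b,c_0,c_1\}$ (discrete), $C_M=a^*b^*Q_M$ and $T_M=C_M+c_0+c_1$ in $\mathcal T\Sigma_M$, and in $\mathcal T\ddot\Sigma_M$ let $$[\![\mathrm{Inc}(1,q)]\!]=a_ra^*b^*q_r,\qquad [\![\mathrm{Inc}(2,q)]\!]=a^*b_rb^*q_r,$$ $$[\![\mathrm{If}(1,q_1,q_2)]\!]=b^*(q_1)_r+a_la^*b^*(q_2)_r,\qquad [\![\mathrm{If}(2,q_1,q_2)]\!]=a^*(q_1)_r+a^*b_lb^*(q_2)_r,\qquad [\![\mathrm{Halt}(x)]\!]=(c_x)_r,$$ $$R_M=\sum_{q\in Q_M}[\![\iota(q)]\!]\,q_l,\qquad \Sigma_M^{\ne}=\sum_{x,y\in\Sigma_M,\;x\ne y}x_ly_r .$$ **Theorem (Completeness).** There is an algorithm that, given a two-counter machine $M$ and a configuration $s\le T_M$ (a word over $\Sigma_M$),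 computes a term $\rho\in\mathcal T\ddot\Sigma_M$ (as a syntax tree) with the following property. If $s\to_{R_M}^*c_1$, then $$s_r\,R_M^*\;\le\;\Sigma_M^*\,(C_M+c_1)_r+\Sigma_M^*\,\Sigma_M^{\ne}\,\rho$$ holds in the free pre-Kleene algebra $\mathcal T\ddot\Sigma_M$ (that is, without any induction axioms). -/

import Mathlib

open scoped Computability

/-! ### Pre-Kleene algebras -/

namespace PreKA

universe u v w

/-- A (left-biased) pre-Kleene algebra: an idempotent semiring (Mathlib's `IdemSemiring`, whose
order satisfies `x ≤ y ↔ x + y = y`) with a star operation satisfying left unfolding only. -/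
class PreKleeneAlgebra (A : Type u) extends IdemSemiring A, KStar A where
  kstar_unfold (x : A) : x∗ = 1 + x * x∗

/-- Morphisms of pre-Kleene algebras: maps that commute with all the operations. -/
structure Hom (A : Type u) (B : Type v) [PreKleeneAlgebra A] [PreKleeneAlgebra B]
    extends A →+* B where
  map_kstar' (x : A) : toFun (x∗) = (toFun x)∗

instance Hom.instFunLike {A : Type u} {B : Type v} [PreKleeneAlgebra A] [PreKleeneAlgebra B] :
    FunLike (Hom A B) A B where
  coe f := f.toFun
  coe_injective f g h := by
    cases f; cases g; congr 1; exact DFunLike.coe_injective h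

instance Hom.instRingHomClass {A : Type u} {B : Type v} [PreKleeneAlgebra A]
    [PreKleeneAlgebra B] : RingHomClass (Hom A B) A B where
  map_mul f := f.map_mul'
  map_one f := f.map_one'
  map_add f := f.map_add'
  map_zero f := f.map_zero'

theorem Hom.map_kstar {A : Type u} {B : Type v} [PreKleeneAlgebra A] [PreKleeneAlgebra B]
    (f : Hom A B) (x : A) : f (x∗) = (f x)∗ :=
  f.map_kstar' x

/-! ### Commutable sets -/

/-- A commutable set: a type with a reflexive symmetric relation. -/
class Commutable (X : Type u) where
  Comm : X → X → Prop
  refl (x : X) : Comm x x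
  symm {x y : X} : Comm x y → Comm y x

/-- The discrete commuting relation (equality). -/
@[reducible] def Commutable.discrete (X : Type u) : Commutable X where
  Comm x y := x = y
  refl _ := rfl
  symm h := h.symm

/-- The commuting relation on the disjoint union of two commutable sets: left symbols commute with
right symbols, and the relation on each side is the given one. -/
def SumComm {X : Type u} {Y : Type v} [Commutable X] [Commutable Y] : X ⊕ Y → X ⊕ Y → Prop
  | .inl x, .inl x' => Commutable.Comm x x'
  | .inr y, .inr y' => Commutable.Comm y y'
  | .inl _, .inr _ => True
  | .inr _, .inl _ => True

instance Commutable.instSum {X : Type u} {Y : Type v} [Commutable X] [Commutable Y] :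
    Commutable (X ⊕ Y) where
  Comm := SumComm
  refl z := by cases z <;> exact Commutable.refl (_ : _)
  symm {z z'} h := by
    cases z <;> cases z' <;> first | trivial | exact Commutable.symm (h : Commutable.Comm _ _)

/-! ### The free pre-Kleene algebra on a commutable set -/

/-- Syntax trees over the symbols `X`. -/
inductive KTerm (X : Type u) : Type u
  | var (x : X)
  | zero
  | one
  | add (s t : KTerm X)
  | mul (s t : KTerm X)
  | star (s : KTerm X)

/-- Provable equality: the least congruence that contains the axioms of pre-Kleene algebra and
the commutativity conditions of `X`. -/
inductive KEq {X : Type u} [Commutable X] : KTerm X → KTerm X → Prop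
  | refl (s : KTerm X) : KEq s s
  | symm {s t : KTerm X} : KEq s t → KEq t s
  | trans {s t r : KTerm X} : KEq s t → KEq t r → KEq s r
  | add_congr {s s' t t' : KTerm X} : KEq s s' → KEq t t' → KEq (s.add t) (s'.add t')
  | mul_congr {s s' t t' : KTerm X} : KEq s s' → KEq t t' → KEq (s.mul t) (s'.mul t')
  | star_congr {s s' : KTerm X} : KEq s s' → KEq s.star s'.star
  | one_mul (s : KTerm X) : KEq (KTerm.one.mul s) s
  | mul_one (s : KTerm X) : KEq (s.mul .one) s
  | zero_mul (s : KTerm X) : KEq (KTerm.zero.mul s) .zero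
  | mul_zero (s : KTerm X) : KEq (s.mul .zero) .zero
  | mul_assoc (s t r : KTerm X) : KEq ((s.mul t).mul r) (s.mul (t.mul r))
  | zero_add (s : KTerm X) : KEq (KTerm.zero.add s) s
  | add_comm (s t : KTerm X) : KEq (s.add t) (t.add s)
  | add_assoc (s t r : KTerm X) : KEq ((s.add t).add r) (s.add (t.add r))
  | add_idem (s : KTerm X) : KEq (s.add s) s
  | mul_add (s t r : KTerm X) : KEq (s.mul (t.add r)) ((s.mul t).add (s.mul r))
  | add_mul (s t r : KTerm X) : KEq ((s.add t).mul r) ((s.mul r).add (t.mul r))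
  | star_unfold (s : KTerm X) : KEq s.star (KTerm.one.add (s.mul s.star))
  | comm {x y : X} : Commutable.Comm x y →
      KEq ((KTerm.var x).mul (.var y)) ((KTerm.var y).mul (.var x))

/-- Provable equality as a setoid. -/
def KTerm.setoid (X : Type u) [Commutable X] : Setoid (KTerm X) where
  r := KEq
  iseqv := ⟨KEq.refl, KEq.symm, KEq.trans⟩

/-- The free pre-Kleene algebra on a commutable set. -/
def Free (X : Type u) [Commutable X] : Type u := Quotient (KTerm.setoid X)

namespace Free

/-- The element of the free algebra denoted by a syntax tree. -/
def mk {X : Type u} [Commutable X] (t : KTerm X) : Free X := Quotient.mk (KTerm.setoid X) t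

/-- The generator given by a symbol. -/
def var {X : Type u} [Commutable X] (x : X) : Free X := mk (.var x)

theorem mk_eq_mk {X : Type u} [Commutable X] {s t : KTerm X} : mk s = mk t ↔ KEq s t :=
  Quotient.eq (r := KTerm.setoid X)

theorem ind {X : Type u} [Commutable X] {p : Free X → Prop} (h : ∀ t, p (mk t)) (x : Free X) :
    p x :=
  Quotient.ind h x

instance instZero (X : Type u) [Commutable X] : Zero (Free X) := ⟨mk .zero⟩

instance instOne (X : Type u) [Commutable X] : One (Free X) := ⟨mk .one⟩

instance instAdd (X : Type u) [Commutable X] : Add (Free X) :=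
  ⟨Quotient.map₂ KTerm.add fun _ _ h _ _ h' => KEq.add_congr h h'⟩

instance instMul (X : Type u) [Commutable X] : Mul (Free X) :=
  ⟨Quotient.map₂ KTerm.mul fun _ _ h _ _ h' => KEq.mul_congr h h'⟩

instance instSemiring (X : Type u) [Commutable X] : Semiring (Free X) where
  nsmul := nsmulRec
  add_assoc x y z := by
    induction x using ind; induction y using ind; induction z using ind
    exact mk_eq_mk.2 (.add_assoc _ _ _)
  zero_add x := by
    induction x using ind
    exact mk_eq_mk.2 (.zero_add _)
  add_zero x := by
    induction x using ind
    exact mk_eq_mk.2 ((KEq.add_comm _ _).trans (.zero_add _))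
  add_comm x y := by
    induction x using ind; induction y using ind
    exact mk_eq_mk.2 (.add_comm _ _)
  mul_assoc x y z := by
    induction x using ind; induction y using ind; induction z using ind
    exact mk_eq_mk.2 (.mul_assoc _ _ _)
  one_mul x := by
    induction x using ind
    exact mk_eq_mk.2 (.one_mul _)
  mul_one x := by
    induction x using ind
    exact mk_eq_mk.2 (.mul_one _)
  zero_mul x := by
    induction x using ind
    exact mk_eq_mk.2 (.zero_mul _)
  mul_zero x := by
    induction x using ind
    exact mk_eq_mk.2 (.mul_zero _)
  left_distrib x y z := by
    induction x using ind; induction y using ind; induction z using ind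
    exact mk_eq_mk.2 (.mul_add _ _ _)
  right_distrib x y z := by
    induction x using ind; induction y using ind; induction z using ind
    exact mk_eq_mk.2 (.add_mul _ _ _)

instance instKStar (X : Type u) [Commutable X] : KStar (Free X) where
  kstar := Quotient.map KTerm.star fun _ _ h => KEq.star_congr h

instance instPreKleeneAlgebra (X : Type u) [Commutable X] : PreKleeneAlgebra (Free X) where
  toIdemSemiring := IdemSemiring.ofSemiring fun x => by
    induction x using ind
    exact mk_eq_mk.2 (.add_idem _)
  kstar_unfold x := by
    induction x using ind
    exact mk_eq_mk.2 (.star_unfold _)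

/-- Commuting symbols commute in the free algebra. -/
theorem var_mul_var {X : Type u} [Commutable X] {x y : X} (h : Commutable.Comm x y) :
    var x * var y = var y * var x :=
  mk_eq_mk.2 (.comm h)

end Free

/-- Evaluation of a syntax tree in a pre-Kleene algebra. -/
def KTerm.eval {X : Type u} {A : Type v} [PreKleeneAlgebra A] (f : X → A) : KTerm X → A
  | .var x => f x
  | .zero => 0
  | .one => 1
  | .add s t => s.eval f + t.eval f
  | .mul s t => s.eval f * t.eval f
  | .star s => (s.eval f)∗

theorem KEq.eval {X : Type u} [Commutable X] {A : Type v} [PreKleeneAlgebra A] {f : X → A}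
    (hf : ∀ x y, Commutable.Comm x y → f x * f y = f y * f x) {s t : KTerm X} (h : KEq s t) :
    s.eval f = t.eval f := by
  induction h with
  | refl => rfl
  | symm _ ih => exact ih.symm
  | trans _ _ ih ih' => exact ih.trans ih'
  | add_congr _ _ ih ih' => simp only [KTerm.eval, ih, ih']
  | mul_congr _ _ ih ih' => simp only [KTerm.eval, ih, ih']
  | star_congr _ ih => simp only [KTerm.eval, ih]
  | one_mul => exact _root_.one_mul _
  | mul_one => exact _root_.mul_one _
  | zero_mul => exact MulZeroClass.zero_mul _
  | mul_zero => exact MulZeroClass.mul_zero _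
  | mul_assoc => exact _root_.mul_assoc _ _ _
  | zero_add => exact _root_.zero_add _
  | add_comm => exact _root_.add_comm _ _
  | add_assoc => exact _root_.add_assoc _ _ _
  | add_idem => exact _root_.add_idem _
  | mul_add => exact _root_.mul_add _ _ _
  | add_mul => exact _root_.add_mul _ _ _
  | star_unfold => exact PreKleeneAlgebra.kstar_unfold _
  | comm h => exact hf _ _ h

namespace Free

/-- The universal property: the morphism out of the free algebra that extends a map on symbols
which preserves the commuting relation. -/
def lift {X : Type u} [Commutable X] {A : Type v} [PreKleeneAlgebra A] (f : X → A)
    (hf : ∀ x y, Commutable.Comm x y → f x * f y = f y * f x) : Hom (Free X) A where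
  toFun := Quotient.lift (KTerm.eval f) fun _ _ h => KEq.eval hf h
  map_zero' := rfl
  map_one' := rfl
  map_add' x y := by
    induction x using ind; induction y using ind
    rfl
  map_mul' x y := by
    induction x using ind; induction y using ind
    rfl
  map_kstar' x := by
    induction x using ind
    rfl

theorem lift_var {X : Type u} [Commutable X] {A : Type v} [PreKleeneAlgebra A] (f : X → A)
    (hf : ∀ x y, Commutable.Comm x y → f x * f y = f y * f x) (x : X) :
    lift f hf (var x) = f x :=
  rfl

/-- Uniqueness in the universal property. -/
theorem hom_ext {X : Type u} [Commutable X] {A : Type v} [PreKleeneAlgebra A]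
    {φ ψ : Hom (Free X) A} (h : ∀ x, φ (var x) = ψ (var x)) : φ = ψ := by
  refine DFunLike.ext _ _ fun y => ?_
  induction y using ind with
  | h t =>
    induction t with
    | var x => exact h x
    | zero => exact (map_zero φ).trans (map_zero ψ).symm
    | one => exact (map_one φ).trans (map_one ψ).symm
    | add s t ihs iht =>
      change φ (mk s + mk t) = ψ (mk s + mk t)
      rw [map_add, map_add, ihs, iht]
    | mul s t ihs iht =>
      change φ (mk s * mk t) = ψ (mk s * mk t)
      rw [map_mul, map_mul, ihs, iht]
    | star s ih =>
      change φ ((mk s)∗) = ψ ((mk s)∗)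
      rw [Hom.map_kstar, Hom.map_kstar, ih]

/-- `e ↦ e_l`, induced by the left injection `x ↦ x_l`. -/
def left {X : Type u} {Y : Type v} [Commutable X] [Commutable Y] : Hom (Free X) (Free (X ⊕ Y)) :=
  lift (fun x => var (.inl x)) fun _ _ h => var_mul_var (X := X ⊕ Y) h

/-- `e ↦ e_r`, induced by the right injection `y ↦ y_r`. -/
def right {X : Type u} {Y : Type v} [Commutable X] [Commutable Y] : Hom (Free Y) (Free (X ⊕ Y)) :=
  lift (fun y => var (.inr y)) fun _ _ h => var_mul_var (X := X ⊕ Y) h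

/-- A term over `X` viewed as a term over `X ⊕ X`, by mapping each symbol `x` to `x_l x_r`. -/
def diag {X : Type u} [Commutable X] : Hom (Free X) (Free (X ⊕ X)) :=
  lift (fun x => var (.inl x) * var (.inr x)) fun x y h => by
    have hl : Commute (var (.inl x) : Free (X ⊕ X)) (var (.inl y)) :=
      var_mul_var (X := X ⊕ X) h
    have hr : Commute (var (.inr x) : Free (X ⊕ X)) (var (.inr y)) :=
      var_mul_var (X := X ⊕ X) h
    have hc : ∀ z t : X, Commute (var (.inl z) : Free (X ⊕ X)) (var (.inr t)) := fun z t =>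
      var_mul_var (X := X ⊕ X) (x := .inl z) (y := .inr t) trivial
    exact (hl.mul_right (hc x y)).mul_left ((hc y x).symm.mul_right hr)

/-- The element of the free algebra given by a word. -/
def word {X : Type u} [Commutable X] (s : List X) : Free X := (s.map var).prod

/-- `s →_e s'`, the relation on words denoted by a term `e` over `X ⊕ X`. -/
def Step {X : Type u} [Commutable X] (e : Free (X ⊕ X)) (s s' : List X) : Prop :=
  left (word s) * right (word s') ≤ e

end Free

/-! ### Two-counter machines -/

/-- The two counters. -/
inductive Counter
  | one
  | two

/-- Instructions over the control states `Q`: `Inc(r, q)`, `If(r, q₁, q₂)`, and `Halt(x)` with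
`x ∈ {0, 1}`. -/
inductive Instr (Q : Type u) : Type u
  | inc (r : Counter) (q : Q)
  | ite (r : Counter) (q₁ q₂ : Q)
  | halt (x : Fin 2)

/-- A two-counter machine with control states `Q` (assumed finite where machines are used). -/
structure Machine (Q : Type u) where
  init : Q
  trans : Q → Instr Q

/-- The symbols `Q + {a, b, c₀, c₁}`. -/
inductive Symb (Q : Type u) : Type u
  | state (q : Q)
  | a
  | b
  | c (x : Fin 2)
  deriving DecidableEq, Fintype

/-- The symbols of a machine form a discrete commutable set. -/
instance Symb.instCommutable (Q : Type u) : Commutable (Symb Q) := Commutable.discrete _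

namespace Machine

open Free

variable {Q : Type u}

/-- `a* b*`. -/
def counters (Q : Type u) : Free (Symb Q) := (var .a)∗ * (var .b)∗

/-- The running configurations `C_M = a* b* Q`. -/
def running (Q : Type u) [Fintype Q] : Free (Symb Q) := counters Q * ∑ q : Q, var (.state q)

/-- All configurations, `T_M = C_M + c₀ + c₁`. -/
def configs (Q : Type u) [Fintype Q] : Free (Symb Q) :=
  running Q + (var (.c 0) + var (.c 1))

/-- The interpretation of an instruction as a term over two copies of the symbols. -/
def instrTerm : Instr Q → Free (Symb Q ⊕ Symb Q)
  | .inc .one q =>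
      right (var .a) * diag ((var .a)∗) * diag ((var .b)∗) * right (var (.state q))
  | .inc .two q =>
      diag ((var .a)∗) * right (var .b) * diag ((var .b)∗) * right (var (.state q))
  | .ite .one q₁ q₂ =>
      diag ((var .b)∗) * right (var (.state q₁)) +
        left (var .a) * diag ((var .a)∗) * diag ((var .b)∗) * right (var (.state q₂))
  | .ite .two q₁ q₂ =>
      diag ((var .a)∗) * right (var (.state q₁)) +
        diag ((var .a)∗) * left (var .b) * diag ((var .b)∗) * right (var (.state q₂))
  | .halt x => right (var (.c x))

/-- The transition relation `R_M`. -/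
def transition [Fintype Q] (M : Machine Q) : Free (Symb Q ⊕ Symb Q) :=
  ∑ q : Q, instrTerm (M.trans q) * left (var (.state q))

/-- `Σ_M*`, viewed as a term over two copies of the symbols. -/
def sigmaStar (Q : Type u) [Fintype Q] : Free (Symb Q ⊕ Symb Q) :=
  diag ((∑ x : Symb Q, var x)∗)

/-- `Σ_M^≠`, the sum of `x_l y_r` over all pairs of distinct symbols. -/
def sigmaNe (Q : Type u) [Fintype Q] [DecidableEq Q] : Free (Symb Q ⊕ Symb Q) :=
  ∑ p : Symb Q × Symb Q with p.1 ≠ p.2, left (var p.1) * right (var p.2)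

end Machine

/-! ### Effective encodings

Given an enumeration of the control states by natural numbers, instructions, symbols and syntax
trees are encoded as natural numbers through the pairing function; a machine is encoded as the
number of its initial state with the list of the codes of its instructions. -/

/-- Code of a counter. -/
def Counter.code : Counter → ℕ
  | .one => 1
  | .two => 2

/-- Code of an instruction, given codes of the states. -/
def Instr.code {Q : Type u} (c : Q → ℕ) : Instr Q → ℕ
  | .inc r q => Nat.pair 0 (Nat.pair r.code (c q))
  | .ite r q₁ q₂ => Nat.pair 1 (Nat.pair r.code (Nat.pair (c q₁) (c q₂)))
  | .halt x => Nat.pair 2 x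

/-- Code of a machine, given a numbering of the states. -/
def Machine.code {Q : Type u} {n : ℕ} (e : Q ≃ Fin n) (M : Machine Q) : ℕ × List ℕ :=
  (e M.init, List.ofFn fun i : Fin n => (M.trans (e.symm i)).code fun q => e q)

/-- Code of a symbol, given codes of the states. -/
def Symb.code {Q : Type u} (c : Q → ℕ) : Symb Q → ℕ
  | .a => 0
  | .b => 1
  | .c x => 2 + x
  | .state q => 4 + c q

/-- Code of a symbol tagged with its side. -/
def sumCode {X : Type u} {Y : Type v} (c : X → ℕ) (d : Y → ℕ) : X ⊕ Y → ℕ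
  | .inl x => Nat.pair 0 (c x)
  | .inr y => Nat.pair 1 (d y)

/-- Code of a syntax tree, given codes of the symbols. -/
def KTerm.code {X : Type u} (c : X → ℕ) : KTerm X → ℕ
  | .zero => Nat.pair 0 0
  | .one => Nat.pair 0 1
  | .var x => Nat.pair 1 (c x)
  | .add s t => Nat.pair 2 (Nat.pair (s.code c) (t.code c))
  | .mul s t => Nat.pair 3 (Nat.pair (s.code c) (t.code c))
  | .star s => Nat.pair 4 (s.code c)

/-- Code of a syntax tree over two copies of the symbols, given a numbering of the states. -/
def Machine.termCode {Q : Type u} {n : ℕ} (e : Q ≃ Fin n) (t : KTerm (Symb Q ⊕ Symb Q)) : ℕ :=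
  t.code (sumCode (Symb.code fun q => e q) (Symb.code fun q => e q))

/-- Code of a word over the symbols, given a numbering of the states. -/
def Machine.wordCode {Q : Type u} {n : ℕ} (e : Q ≃ Fin n) (s : List (Symb Q)) : List ℕ :=
  s.map (Symb.code fun q => e q)

end PreKA

/-! The residual is `ρ = right Σ* * tail * R*`; it depends only on the machine. The run from `s` to
`c₁` is finite and `R_M` is deterministic, so `R*` need only be unfolded once per step of the run,
plus once more at `c₁`. This recursion on the run replaces the missing induction axioms. For one
step, in the product `s_r R` every left symbol of `R` commutes past the right word and meets its
first letter. If they agree, they form a diagonal letter that goes to the front. If they differ, the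
product is below `Σ* Σ^≠` followed by a right word and a suffix of `R`, hence below `mismatch`.
Right symbols of `R` join the end of the word, which therefore behaves like a queue. A starred
letter `x*` facing a word `xⁿ y …` with `y ≠ x` is unfolded `n + 1` times, and after that every
summand has met a mismatch or has left the star (`Bounded.star_mul`). So the configuration word `w`
of a step `w → s'` satisfies `w_r R ≤ w s'_r + mismatch` (`bounded_transition`), and `c₁` satisfies
the same with only the mismatch, since no instruction reads `c₁`. These bounds are chained by
`right_word_mul_star_le`, where `Σ*` absorbs the diagonal prefix `w`. Steps are defined by provable
inequalities, so they are first interpreted in the model of sets of pairs of words, which shows that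
they are true machine steps (`exists_next_of_step`). Computability follows by building the code of
`ρ` with primitive recursive operations on codes. -/

namespace PreKA

universe u v w

/-! ### Order and left unfolding in a pre-Kleene algebra. -/

section PreKleeneAlgebra

variable {A : Type u} [PreKleeneAlgebra A]

theorem one_le_star (x : A) : 1 ≤ x∗ := by
  rw [PreKleeneAlgebra.kstar_unfold]
  exact le_self_add

theorem mul_star_le_star (x : A) : x * x∗ ≤ x∗ := by
  conv_rhs => rw [PreKleeneAlgebra.kstar_unfold]
  exact le_add_self

theorem Hom.monotone {B : Type v} [PreKleeneAlgebra B] (f : Hom A B) : Monotone f := by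
  intro x y h
  rw [← add_eq_right_iff_le] at h ⊢
  rw [← map_add, h]

theorem le_sum_of_mem {ι : Type*} {s : Finset ι} (f : ι → A) {i : ι} (hi : i ∈ s) :
    f i ≤ ∑ j ∈ s, f j := by
  classical
  rw [← Finset.add_sum_erase s f hi]
  exact le_self_add

theorem sum_le_of_forall_le {ι : Type*} {s : Finset ι} {f : ι → A} {y : A}
    (h : ∀ i ∈ s, f i ≤ y) : ∑ j ∈ s, f j ≤ y :=
  Finset.sum_induction f (· ≤ y) (fun _ _ => add_le) (zero_le) h

end PreKleeneAlgebra

/-! ### Words in the free algebra. -/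

namespace Free

variable {X : Type u} [Commutable X]

theorem word_nil : word ([] : List X) = 1 := rfl

theorem word_cons (x : X) (s : List X) : word (x :: s) = var x * word s := by
  simp [word]

theorem word_append (s t : List X) : word (s ++ t) = word s * word t := by
  simp [word]

theorem word_singleton (x : X) : word [x] = var x := by
  simp [word]

/-- This lets a left symbol of a transition travel over the whole right word and meet its first
letter. -/
theorem commute_left_right {Y : Type v} [Commutable Y] (s : List X) (t : List Y) :
    Commute (left (Y := Y) (word s)) (right (X := X) (word t)) := by
  induction s with
  | nil => rw [word_nil, map_one]; exact Commute.one_left _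
  | cons x s ih =>
    rw [word_cons, map_mul]
    refine Commute.mul_left ?_ ih
    clear ih
    induction t with
    | nil => rw [word_nil, map_one]; exact Commute.one_right _
    | cons y t iht =>
      rw [word_cons, map_mul]
      exact Commute.mul_right (var_mul_var (X := X ⊕ Y) (x := .inl x) (y := .inr y) trivial) iht

theorem commute_left_var_right (x : X) (t : List X) :
    Commute (left (Y := X) (var x)) (right (X := X) (word t)) := by
  simpa only [word_singleton] using commute_left_right [x] t

theorem diag_var (x : X) : diag (var x) = left (var x) * right (var x) := rfl

theorem word_le_star_sum [Fintype X] (s : List X) : word s ≤ (∑ x : X, var x)∗ := by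
  induction s with
  | nil => exact one_le_star _
  | cons x s ih =>
    rw [word_cons]
    exact (mul_le_mul' (le_sum_of_mem var (Finset.mem_univ x)) ih).trans (mul_star_le_star _)

theorem word_replicate_le_star (x : X) (n : ℕ) : word (List.replicate n x) ≤ (var x)∗ := by
  induction n with
  | zero => exact one_le_star _
  | succ n ih =>
    rw [List.replicate_succ, word_cons]
    exact (mul_le_mul_right ih _).trans (mul_star_le_star _)

end Free

/-! ### Matching a right word against a term, up to a mismatch. -/

namespace Machine

open Free

variable {Q : Type u} [Fintype Q]

/-- `Σ_M*` as a term over the symbols. -/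
def allWords (Q : Type u) [Fintype Q] : Free (Symb Q) := (∑ x : Symb Q, var x)∗

/-- Letters are absorbed one at a time from the left, by `x * y∗ ≤ y∗` for `x ≤ y`; left unfolding
is enough for this. -/
theorem diag_word_mul_sigmaStar_le (s : List (Symb Q)) :
    diag (word s) * sigmaStar Q ≤ sigmaStar Q := by
  induction s with
  | nil => rw [word_nil, map_one, one_mul]
  | cons x s ih =>
    rw [word_cons, map_mul, mul_assoc]
    refine (mul_le_mul_right ih _).trans ?_
    rw [sigmaStar, ← map_mul]
    exact Hom.monotone _ ((mul_le_mul_left (le_sum_of_mem var (Finset.mem_univ x)) _).trans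
      (mul_star_le_star _))

/-- An upper bound of every suffix of a transition term. -/
def tail (Q : Type u) [Fintype Q] : Free (Symb Q ⊕ Symb Q) :=
  diag ((var .a)∗) * (left (allWords Q) * (right (allWords Q) *
    (diag ((var .b)∗) * (right (allWords Q) * left (allWords Q)))))

/-- Every factor of `tail` is above `1`, so a factor absent from a suffix is filled by some `zᵢ =
1`. One term thus bounds what remains after any left symbol of any instruction. -/
theorem le_tail {z₁ z₂ z₃ z₄ z₅ z₆ : Free (Symb Q ⊕ Symb Q)}
    (h₁ : z₁ ≤ diag ((var .a)∗)) (h₂ : z₂ ≤ left (allWords Q)) (h₃ : z₃ ≤ right (allWords Q))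
    (h₄ : z₄ ≤ diag ((var .b)∗)) (h₅ : z₅ ≤ right (allWords Q)) (h₆ : z₆ ≤ left (allWords Q)) :
    z₁ * (z₂ * (z₃ * (z₄ * (z₅ * z₆)))) ≤ tail Q :=
  mul_le_mul' h₁ (mul_le_mul' h₂ (mul_le_mul' h₃ (mul_le_mul' h₄ (mul_le_mul' h₅ h₆))))

theorem var_le_allWords (x : Symb Q) : var x ≤ allWords Q := by
  rw [← word_singleton]
  exact word_le_star_sum _

theorem one_le_hom_star {A : Type v} {B : Type w} [PreKleeneAlgebra A] [PreKleeneAlgebra B]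
    (f : Hom A B) (x : A) : 1 ≤ f (x∗) := by
  rw [Hom.map_kstar]
  exact one_le_star _

variable [DecidableEq Q]

/-- The sum of the pairs of words with a mismatch, followed by a suffix of a transition. -/
def mismatch (Q : Type u) [Fintype Q] [DecidableEq Q] : Free (Symb Q ⊕ Symb Q) :=
  sigmaStar Q * sigmaNe Q * (right (allWords Q) * tail Q)

/-- `s_r z` is below `g` up to a mismatch. -/
def Bounded (s : List (Symb Q)) (z g : Free (Symb Q ⊕ Symb Q)) : Prop :=
  right (word s) * z ≤ g + mismatch Q

/-- Letters matched before a mismatch are absorbed by the `Σ*` in front of it. -/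
theorem diag_word_mul_mismatch_le (s : List (Symb Q)) :
    diag (word s) * mismatch Q ≤ mismatch Q := by
  rw [mismatch, ← mul_assoc, ← mul_assoc (diag _)]
  exact mul_le_mul_left (mul_le_mul_left (diag_word_mul_sigmaStar_le s) _) _

namespace Bounded

variable {s : List (Symb Q)} {x y : Symb Q} {z z' g g' : Free (Symb Q ⊕ Symb Q)}

theorem mono (h : Bounded s z g) (hg : g ≤ g') : Bounded s z g' :=
  h.trans (add_le_add_left hg _)

theorem add (h : Bounded s z g) (h' : Bounded s z' g) : Bounded s (z + z') g := by
  rw [Bounded, mul_add]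
  exact add_le h h'

theorem one (s : List (Symb Q)) : Bounded s 1 (right (word s)) := by
  rw [Bounded, mul_one]
  exact le_self_add

/-- A right symbol is written at the back of the queue. -/
theorem right_var_mul (h : Bounded (s ++ [x]) z g) : Bounded s (right (var x) * z) g := by
  rw [Bounded, word_append, word_singleton, map_mul] at h
  rwa [Bounded, ← mul_assoc]

/-- The left symbol is read at the front of the queue: it commutes past `s` and then pairs with the
leading right letter. -/
theorem left_var_mul (h : Bounded s z g) :
    Bounded (x :: s) (left (var x) * z) (diag (var x) * g) := by
  have e : right (word (x :: s)) * (left (var x) * z) = diag (var x) * (right (word s) * z) := by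
    rw [word_cons, map_mul, diag_var]
    have h₁ := commute_left_var_right x s
    have h₂ := commute_left_var_right x [x]
    rw [word_singleton] at h₂
    rw [mul_assoc, ← mul_assoc (right (word s)), ← h₁.eq, mul_assoc, ← mul_assoc, ← h₂.eq]
  rw [Bounded, e]
  refine (mul_le_mul_right h _).trans ?_
  rw [mul_add, ← word_singleton]
  exact add_le_add_right (diag_word_mul_mismatch_le _) _

theorem left_var_mul_of_ne (hxy : x ≠ y) (hz : z ≤ tail Q) :
    Bounded (y :: s) (left (var x) * z) g := by
  -- The leading `1` is the part that is bounded by `Σ*`: the mismatch occurs at the first letter.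
  have e : right (word (y :: s)) * (left (var x) * z) =
      1 * (left (var x) * right (var y)) * (right (word s) * z) := by
    rw [← mul_assoc, ← (commute_left_var_right x (y :: s)).eq, word_cons, map_mul]
    simp only [mul_assoc, one_mul]
  rw [Bounded, e]
  refine le_trans ?_ le_add_self
  refine mul_le_mul' (mul_le_mul' (one_le_hom_star _ _) ?_)
    (mul_le_mul' (Hom.monotone _ (word_le_star_sum s)) hz)
  exact le_sum_of_mem (fun p : Symb Q × Symb Q => left (var p.1) * right (var p.2))
    (i := (x, y)) (by simpa using hxy)

/-- One unfolding suffices: `x* z = z + x_l x_r x* z`, and in the second summand `x_l` already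
clashes with `y_r`. The remaining star goes whole into `tail`, which is what `hz` is for. -/
theorem star_mul_of_ne (hxy : x ≠ y) (hz : diag ((var x)∗) * z ≤ tail Q)
    (h : Bounded (y :: s) z g) : Bounded (y :: s) (diag ((var x)∗) * z) g := by
  have e : diag ((var x)∗) * z =
      z + left (var x) * (right (var x) * (diag ((var x)∗) * z)) := by
    conv_lhs => rw [PreKleeneAlgebra.kstar_unfold, map_add, map_one, map_mul, diag_var]
    simp only [add_mul, one_mul, mul_assoc]
  -- The right half `x_r` of the unfolded letter joins the end of `s`, and the longer word is still
  -- below `Σ*`.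
  have e' : right (word (y :: s)) * (left (var x) * (right (var x) * (diag ((var x)∗) * z))) =
      1 * (left (var x) * right (var y)) * (right (word (s ++ [x])) * (diag ((var x)∗) * z)) := by
    rw [← mul_assoc, ← (commute_left_var_right x (y :: s)).eq, word_cons, word_append, map_mul,
      map_mul, word_singleton]
    simp only [mul_assoc, one_mul]
  rw [e]
  refine h.add ?_
  rw [Bounded, e']
  refine le_trans ?_ le_add_self
  refine mul_le_mul' (mul_le_mul' (one_le_hom_star _ _) ?_)
    (mul_le_mul' (Hom.monotone _ (word_le_star_sum _)) hz)
  exact le_sum_of_mem (fun p : Symb Q × Symb Q => left (var p.1) * right (var p.2))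
    (i := (x, y)) (by simpa using hxy)

/-- Each unfolding reads an `x` at the front and writes one at the back. By `h₀`, leaving the star
while an `x` still leads only gives mismatches; once `y` leads, no further iteration can match.
Hence the only surviving summand has moved all `n` letters to the back. -/
theorem star_mul (hxy : x ≠ y) (hz : diag ((var x)∗) * z ≤ tail Q)
    (h₀ : ∀ t, Bounded (x :: t) z 0) (n : ℕ)
    (h : Bounded (y :: s ++ List.replicate n x) z g) :
    Bounded (List.replicate n x ++ y :: s) (diag ((var x)∗) * z)
      (diag (word (List.replicate n x)) * g) := by
  induction n generalizing s with
  | zero =>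
    rw [List.replicate_zero, word_nil, map_one, one_mul]
    exact star_mul_of_ne hxy hz (by simpa using h)
  | succ n ih =>
    have e : diag ((var x)∗) * z =
        z + left (var x) * (right (var x) * (diag ((var x)∗) * z)) := by
      conv_lhs => rw [PreKleeneAlgebra.kstar_unfold, map_add, map_one, map_mul, diag_var]
      simp only [add_mul, one_mul, mul_assoc]
    rw [e, List.replicate_succ, word_cons, map_mul, mul_assoc, List.cons_append]
    refine ((h₀ _).mono (zero_le)).add (left_var_mul (right_var_mul ?_))
    -- The `x` just read has been written behind `s`; this is why the induction generalizes `s`.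
    have := ih (s := s ++ [x]) (by simpa [List.replicate_succ] using h)
    simpa using this

end Bounded

end Machine

/-! ### One step of the machine, as an inequality. -/

namespace Machine

open Free

variable {Q : Type u}

/-- The word `aⁿ bᵐ q`. -/
def config (n m : ℕ) (q : Q) : List (Symb Q) :=
  List.replicate n .a ++ (List.replicate m .b ++ [.state q])

/-- The successor of a configuration with counters `n` and `m` under an instruction. -/
def next : Instr Q → ℕ → ℕ → Option (List (Symb Q))
  | .inc .one q, n, m => some (config (n + 1) m q)
  | .inc .two q, n, m => some (config n (m + 1) q)
  | .ite .one q₁ _, 0, m => some (config 0 m q₁)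
  | .ite .one _ q₂, n + 1, m => some (config n m q₂)
  | .ite .two q₁ _, n, 0 => some (config n 0 q₁)
  | .ite .two _ q₂, n, m + 1 => some (config n m q₂)
  | .halt x, 0, 0 => some [.c x]
  | .halt _, _, _ => none

variable [Fintype Q]

theorem star_b_tail_le (q q' : Q) :
    diag ((var .b)∗) * (right (var (.state q')) * left (var (.state q))) ≤ tail Q := by
  simpa using le_tail (Q := Q) (one_le_hom_star _ _) (one_le_hom_star _ _)
    (one_le_hom_star _ _) le_rfl (Hom.monotone _ (var_le_allWords _))
    (Hom.monotone _ (var_le_allWords _))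

theorem star_a_tail_le (q q' : Q) :
    diag ((var .a)∗) * (right (var (.state q')) * left (var (.state q))) ≤ tail Q := by
  simpa using le_tail (Q := Q) le_rfl (one_le_hom_star _ _)
    (one_le_hom_star _ _) (one_le_hom_star _ _) (Hom.monotone _ (var_le_allWords _))
    (Hom.monotone _ (var_le_allWords _))

theorem star_a_star_b_tail_le (q q' : Q) :
    diag ((var .a)∗) * (diag ((var .b)∗) *
      (right (var (.state q')) * left (var (.state q)))) ≤ tail Q := by
  simpa using le_tail (Q := Q) le_rfl (one_le_hom_star _ _)
    (one_le_hom_star _ _) le_rfl (Hom.monotone _ (var_le_allWords _))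
    (Hom.monotone _ (var_le_allWords _))

theorem star_a_right_star_b_tail_le (x : Symb Q) (q q' : Q) :
    diag ((var .a)∗) * (right (var x) * (diag ((var .b)∗) *
      (right (var (.state q')) * left (var (.state q))))) ≤ tail Q := by
  simpa using le_tail (Q := Q) le_rfl (one_le_hom_star _ _)
    (Hom.monotone _ (var_le_allWords x)) le_rfl (Hom.monotone _ (var_le_allWords _))
    (Hom.monotone _ (var_le_allWords _))

theorem star_a_left_star_b_tail_le (x : Symb Q) (q q' : Q) :
    diag ((var .a)∗) * (left (var x) * (diag ((var .b)∗) *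
      (right (var (.state q')) * left (var (.state q))))) ≤ tail Q := by
  simpa using le_tail (Q := Q) le_rfl (Hom.monotone _ (var_le_allWords x))
    (one_le_hom_star _ _) le_rfl (Hom.monotone _ (var_le_allWords _))
    (Hom.monotone _ (var_le_allWords _))

variable [DecidableEq Q]

namespace Bounded

variable {z g : Free (Symb Q ⊕ Symb Q)}

theorem left_state_of_ne {q : Q} {y : Symb Q} (hy : Symb.state q ≠ y) (s : List (Symb Q)) :
    Bounded (y :: s) (left (var (.state q))) g := by
  rw [← mul_one (left (var (Symb.state q)))]
  refine left_var_mul_of_ne hy ?_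
  simpa using le_tail (Q := Q) (one_le_hom_star _ _) (one_le_hom_star _ _)
    (one_le_hom_star _ _) (one_le_hom_star _ _) (one_le_hom_star _ _) (one_le_hom_star _ _)

/-- The first letter after the block of `a` is `b` or the state, according to `m`; either differs
from `a`, as `star_mul` requires. -/
theorem star_a_mul {q : Q} {s : List (Symb Q)} (hz : diag ((var .a)∗) * z ≤ tail Q)
    (h₀ : ∀ t, Bounded (.a :: t) z 0) (n m : ℕ)
    (h : Bounded (List.replicate m .b ++ .state q :: (s ++ List.replicate n .a)) z g) :
    Bounded (List.replicate n .a ++ (List.replicate m .b ++ .state q :: s))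
      (diag ((var .a)∗) * z) (diag (word (List.replicate n .a)) * g) := by
  cases m with
  | zero => exact star_mul (by simp) hz h₀ n (by simpa using h)
  | succ m =>
    rw [List.replicate_succ] at h ⊢
    exact star_mul (by simp) hz h₀ n (by simpa using h)

theorem star_b_mul {q : Q} {s : List (Symb Q)} (hz : diag ((var .b)∗) * z ≤ tail Q)
    (h₀ : ∀ t, Bounded (.b :: t) z 0) (m : ℕ)
    (h : Bounded (.state q :: (s ++ List.replicate m .b)) z g) :
    Bounded (List.replicate m .b ++ .state q :: s)
      (diag ((var .b)∗) * z) (diag (word (List.replicate m .b)) * g) :=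
  star_mul (by simp) hz h₀ m (by simpa using h)

end Bounded

/-- The word is processed factor by factor until its state letter `q₀` faces the last factor `q_l`.
What happens then is left to `γ`, so that the cases `q = q₀` and `q ≠ q₀` share one argument. When
`next` is undefined the word can never be matched, and the bound is `0`. -/
theorem bounded_instrTerm (i : Instr Q) (q q₀ : Q) (n m : ℕ)
    {γ : List (Symb Q) → Free (Symb Q ⊕ Symb Q)}
    (hγ : ∀ s, Bounded (.state q₀ :: s) (left (var (.state q))) (γ s)) :
    Bounded (config n m q₀) (instrTerm i * left (var (.state q)))
      ((next i n m).elim 0 fun s' =>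
        diag (word (List.replicate n .a)) * (diag (word (List.replicate m .b)) * γ s')) := by
  have right_state (q' : Q) {y : Symb Q} (hy : Symb.state q ≠ y) (s : List (Symb Q)) :
      Bounded (y :: s) (right (var (.state q')) * left (var (.state q))) 0 :=
    .right_var_mul (.left_state_of_ne hy _)
  have star_b (q' : Q) {y : Symb Q} (hy : Symb.state q ≠ y) (hb : Symb.b ≠ y)
      (s : List (Symb Q)) : Bounded (y :: s) (diag ((var .b)∗) *
        (right (var (.state q')) * left (var (.state q)))) 0 :=
    .star_mul_of_ne hb (star_b_tail_le q q') (right_state q' hy s)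
  -- Writing `q'` at the back completes the successor, and `q_l` is then matched against the leading
  -- `q₀`.
  have final (q' : Q) {s t : List (Symb Q)} (h : s ++ [.state q'] = t) : Bounded (.state q₀ :: s)
      (right (var (.state q')) * left (var (.state q))) (γ t) :=
    by subst h; exact .right_var_mul (hγ _)
  match i, n, m with
  | .inc .one q', n, m =>
    simp only [instrTerm, mul_assoc, next, Option.elim, config]
    -- The queue passes through `aⁿ bᵐ q₀ a`, then `bᵐ q₀ a aⁿ`, then `q₀ aⁿ⁺¹ bᵐ`.
    refine .right_var_mul ?_
    simp only [List.append_assoc, List.cons_append, List.nil_append]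
    refine .star_a_mul (star_a_star_b_tail_le q q') (star_b q' (by simp) (by simp)) n m ?_
    refine .star_b_mul (star_b_tail_le q q') (right_state q' (by simp)) m ?_
    exact final q' (by simp [List.replicate_succ])
  | .inc .two q', n, m =>
    simp only [instrTerm, mul_assoc, next, Option.elim, config]
    refine .star_a_mul (star_a_right_star_b_tail_le _ q q')
      (fun t => .right_var_mul (star_b q' (by simp) (by simp) _)) n m ?_
    refine .right_var_mul ?_
    simp only [List.append_assoc, List.cons_append, List.nil_append]
    refine .star_b_mul (star_b_tail_le q q') (right_state q' (by simp)) m ?_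
    exact final q' (by simp [List.replicate_succ])
  | .ite .one q₁ q₂, 0, m =>
    simp only [instrTerm, add_mul, mul_assoc, next, Option.elim, config]
    refine .add ?_ ?_
    · rw [List.replicate_zero, List.nil_append, word_nil, map_one, one_mul]
      refine .star_b_mul (star_b_tail_le q q₁) (right_state q₁ (by simp)) m ?_
      exact final q₁ (by simp)
    -- The non-zero branch must read an `a`, while the word begins with `b` or with `q₀`, according
    -- to `m`.
    · cases m with
      | zero => exact .left_var_mul_of_ne (by simp) (star_a_star_b_tail_le q q₂)
      | succ m => exact .left_var_mul_of_ne (by simp) (star_a_star_b_tail_le q q₂)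
  | .ite .one q₁ q₂, n + 1, m =>
    simp only [instrTerm, add_mul, mul_assoc, next, Option.elim, config]
    refine .add ?_ ?_
    · exact (star_b q₁ (by simp) (by simp) _).mono zero_le
    · rw [List.replicate_succ, List.cons_append, word_cons, map_mul, mul_assoc]
      refine .left_var_mul ?_
      refine .star_a_mul (star_a_star_b_tail_le q q₂) (star_b q₂ (by simp) (by simp)) n m ?_
      refine .star_b_mul (star_b_tail_le q q₂) (right_state q₂ (by simp)) m ?_
      exact final q₂ (by simp)
  | .ite .two q₁ q₂, n, 0 =>
    simp only [instrTerm, add_mul, mul_assoc, next, Option.elim, config]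
    refine .add ?_ ?_
    · refine .star_a_mul (star_a_tail_le q q₁) (right_state q₁ (by simp)) n 0 ?_
      rw [List.replicate_zero, List.nil_append, word_nil, map_one, one_mul]
      exact final q₁ (by simp)
    -- After the `a` block the non-zero branch must read a `b` but meets `q₀`, so nothing but
    -- mismatches survives.
    · refine .mono (.star_a_mul (g := 0) (star_a_left_star_b_tail_le _ q q₂)
        (fun t => .left_var_mul_of_ne (by simp) (star_b_tail_le q q₂)) n 0
          (.left_var_mul_of_ne (by simp) (star_b_tail_le q q₂))) ?_
      simp
  | .ite .two q₁ q₂, n, m + 1 =>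
    simp only [instrTerm, add_mul, mul_assoc, next, Option.elim, config]
    refine .add ?_ ?_
    · refine .mono (.star_a_mul (g := 0) (star_a_tail_le q q₁) (right_state q₁ (by simp)) n (m + 1)
        (right_state q₁ (by simp) _)) ?_
      simp
    · refine .star_a_mul (star_a_left_star_b_tail_le _ q q₂)
        (fun t => .left_var_mul_of_ne (by simp) (star_b_tail_le q q₂)) n (m + 1) ?_
      rw [List.replicate_succ, List.cons_append, word_cons, map_mul, mul_assoc]
      refine .left_var_mul ?_
      refine .star_b_mul (star_b_tail_le q q₂) (right_state q₂ (by simp)) m ?_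
      exact final q₂ (by simp)
  | .halt x, 0, 0 =>
    simp only [instrTerm, next, Option.elim, config, List.replicate_zero, word_nil, map_one, one_mul]
    exact .right_var_mul (hγ _)
  -- The halting term reads a state letter only, so any leftover counter letter in front is a
  -- mismatch.
  | .halt x, n + 1, m =>
    simp only [instrTerm, next, Option.elim, config, List.replicate_succ, List.cons_append]
    exact .right_var_mul (.left_state_of_ne (by simp) _)
  | .halt x, 0, m + 1 =>
    simp only [instrTerm, next, Option.elim, config, List.replicate_succ, List.replicate_zero,
      List.cons_append, List.nil_append]
    exact .right_var_mul (.left_state_of_ne (by simp) _)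

theorem bounded_instrTerm_c (i : Instr Q) (q : Q) (x : Fin 2) (s : List (Symb Q)) :
    Bounded (.c x :: s) (instrTerm i * left (var (.state q))) 0 := by
  have right_state (q' : Q) (s : List (Symb Q)) :
      Bounded (.c x :: s) (right (var (.state q')) * left (var (.state q))) 0 :=
    .right_var_mul (.left_state_of_ne (by simp) _)
  have star_b (q' : Q) (s : List (Symb Q)) : Bounded (.c x :: s) (diag ((var .b)∗) *
      (right (var (.state q')) * left (var (.state q)))) 0 :=
    .star_mul_of_ne (by simp) (star_b_tail_le q q') (right_state q' s)
  match i with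
  | .inc .one q' =>
    simp only [instrTerm, mul_assoc]
    exact .right_var_mul (.star_mul_of_ne (by simp) (star_a_star_b_tail_le q q') (star_b q' _))
  | .inc .two q' =>
    simp only [instrTerm, mul_assoc]
    exact .star_mul_of_ne (by simp) (star_a_right_star_b_tail_le _ q q')
      (.right_var_mul (star_b q' _))
  | .ite .one q₁ q₂ =>
    simp only [instrTerm, add_mul, mul_assoc]
    exact .add (star_b q₁ _) (.left_var_mul_of_ne (by simp) (star_a_star_b_tail_le q q₂))
  | .ite .two q₁ q₂ =>
    simp only [instrTerm, add_mul, mul_assoc]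
    exact .add (.star_mul_of_ne (by simp) (star_a_tail_le q q₁) (right_state q₁ _))
      (.star_mul_of_ne (by simp) (star_a_left_star_b_tail_le _ q q₂)
        (.left_var_mul_of_ne (by simp) (star_b_tail_le q q₂)))
  | .halt y =>
    simp only [instrTerm]
    exact .right_var_mul (.left_state_of_ne (by simp) _)

/-- Determinism: among the summands of `R_M`, only that of the current state can match the state
letter of the configuration; all others are mismatches. -/
theorem bounded_transition (M : Machine Q) {n m : ℕ} {q : Q} {s : List (Symb Q)}
    (hs : next (M.trans q) n m = some s) :
    Bounded (config n m q) M.transition (diag (word (config n m q)) * right (word s)) := by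
  rw [Bounded, transition, Finset.mul_sum]
  refine sum_le_of_forall_le fun q' _ => ?_
  change Bounded _ _ _
  by_cases h : q' = q
  · subst h
    have := bounded_instrTerm (M.trans q') q' q' n m
      -- Here `q_l` matches the state letter, leaving the successor as the right word.
      (γ := fun s => diag (var (.state q')) * right (word s)) fun s => by
        simpa using Bounded.left_var_mul (x := .state q') (Bounded.one s)
    simpa [hs, config, word_append, word_singleton, mul_assoc] using this
  · refine (bounded_instrTerm (M.trans q') q' q n m (γ := fun _ => 0) fun s =>
      .left_state_of_ne (by simpa using h) s).mono ?_
    cases next (M.trans q') n m <;> simp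

/-- One unfolding of `R*` gives the configuration itself, which lies in `C_M`, and `w_r R R*`. In
the latter, the successor's bound `h` applies behind the diagonal prefix `w`, which `Σ*` absorbs. -/
theorem right_word_mul_star_le (M : Machine Q) {n m : ℕ} {q : Q} {s : List (Symb Q)}
    (hs : next (M.trans q) n m = some s)
    (h : right (word s) * M.transition∗ ≤
      sigmaStar Q * right (running Q + var (.c 1)) + mismatch Q * M.transition∗) :
    right (word (config n m q)) * M.transition∗ ≤
      sigmaStar Q * right (running Q + var (.c 1)) + mismatch Q * M.transition∗ := by
  conv_lhs => rw [PreKleeneAlgebra.kstar_unfold, mul_add, mul_one, ← mul_assoc]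
  refine add_le ?_ ?_
  · refine le_trans ?_ le_self_add
    rw [← one_mul (right (word _))]
    refine mul_le_mul' (one_le_hom_star _ _) (Hom.monotone _ (le_trans ?_ le_self_add))
    rw [config, word_append, word_append, ← mul_assoc, word_singleton]
    exact mul_le_mul' (mul_le_mul' (word_replicate_le_star _ _) (word_replicate_le_star _ _))
      (le_sum_of_mem (fun q => var (Symb.state q)) (Finset.mem_univ q))
  · refine (mul_le_mul_left (bounded_transition M hs) _).trans ?_
    rw [add_mul, mul_assoc]
    refine add_le ?_ le_add_self
    refine (mul_le_mul_right h _).trans ?_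
    rw [mul_add, ← mul_assoc, ← mul_assoc]
    exact add_le_add (mul_le_mul_left (diag_word_mul_sigmaStar_le _) _)
      (mul_le_mul_left (diag_word_mul_mismatch_le _) _)

/-- This ends the recursion: nothing reads `c₁`, so after one unfolding the remaining `R*` stays
behind a mismatch. -/
theorem right_word_c_mul_star_le (M : Machine Q) :
    right (word [.c 1]) * M.transition∗ ≤
      sigmaStar Q * right (running Q + var (.c 1)) + mismatch Q * M.transition∗ := by
  have h : Bounded [.c 1] M.transition 0 := by
    rw [Bounded, transition, Finset.mul_sum]
    refine sum_le_of_forall_le fun q _ => ?_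
    exact bounded_instrTerm_c _ _ _ _
  conv_lhs => rw [PreKleeneAlgebra.kstar_unfold, mul_add, mul_one, ← mul_assoc]
  refine add_le ?_ ?_
  · refine le_trans ?_ le_self_add
    rw [← one_mul (right (word _)), word_singleton]
    exact mul_le_mul' (one_le_hom_star _ _) (Hom.monotone _ le_add_self)
  · refine (mul_le_mul_left h _).trans ?_
    rw [zero_add]
    exact le_add_self

end Machine

/-! ### The model of word relations, and soundness of steps. -/

section SetModel

variable {N : Type u} [Monoid N]

/-- Sets of elements of a monoid, with the generated submonoid as the star. -/
noncomputable instance SetSemiring.instPreKleeneAlgebra : PreKleeneAlgebra (SetSemiring N) where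
  kstar s := Set.up (Submonoid.closure s.down : Set N)
  kstar_unfold s := by
    apply SetSemiring.down.injective
    rw [SetSemiring.down_add, SetSemiring.down_one, SetSemiring.down_mul, SetSemiring.down_up]
    ext x
    constructor
    · intro hx
      induction hx using Submonoid.closure_induction_left with
      | one => exact Or.inl rfl
      | mul_left a ha y hy _ => exact Or.inr (Set.mul_mem_mul ha hy)
    · rintro (rfl | ⟨a, ha, y, hy, rfl⟩)
      · exact one_mem _
      · exact mul_mem (Submonoid.subset_closure ha) hy

theorem SetSemiring.mem_mul {s t : SetSemiring N} {x : N} :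
    x ∈ (s * t).down ↔ ∃ a ∈ s.down, ∃ b ∈ t.down, a * b = x := Iff.rfl

theorem SetSemiring.mem_star_singleton {x y : N} :
    y ∈ ((Set.up {x})∗ : SetSemiring N).down ↔ ∃ n : ℕ, x ^ n = y :=
  Submonoid.mem_closure_singleton

end SetModel

/-- Pairs of words, with componentwise concatenation. -/
abbrev WordPair (X : Type u) : Type u := FreeMonoid X × FreeMonoid X

namespace Free

/-- The relation on words denoted by a term over two copies of a discrete set of symbols. -/
noncomputable def relation {Q : Type u} :
    Hom (Free (Symb Q ⊕ Symb Q)) (SetSemiring (WordPair (Symb Q))) :=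
  lift (fun
    | .inl x => Set.up {(FreeMonoid.of x, 1)}
    | .inr x => Set.up {(1, FreeMonoid.of x)}) fun x y h => by
    match x, y, h with
    | .inl x, .inl y, h => obtain rfl : x = y := h; rfl
    | .inr x, .inr y, h => obtain rfl : x = y := h; rfl
    | .inl x, .inr y, _ => simp [← Set.up_mul]
    | .inr x, .inl y, _ => simp [← Set.up_mul]

variable {Q : Type u}

theorem relation_left_var (x : Symb Q) :
    relation (left (var x)) = Set.up {(FreeMonoid.of x, 1)} := rfl

theorem relation_right_var (x : Symb Q) :
    relation (right (var x)) = Set.up {(1, FreeMonoid.of x)} := rfl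

theorem relation_left_word (s : List (Symb Q)) :
    relation (left (word s)) = Set.up {(FreeMonoid.ofList s, 1)} := by
  induction s with
  | nil => rw [word_nil, map_one, map_one]; rfl
  | cons x s ih =>
    rw [word_cons, map_mul, map_mul, ih, relation_left_var, ← Set.up_mul,
      Set.singleton_mul_singleton]
    rfl

theorem relation_right_word (s : List (Symb Q)) :
    relation (right (word s)) = Set.up {(1, FreeMonoid.ofList s)} := by
  induction s with
  | nil => rw [word_nil, map_one, map_one]; rfl
  | cons x s ih =>
    rw [word_cons, map_mul, map_mul, ih, relation_right_var, ← Set.up_mul,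
      Set.singleton_mul_singleton]
    rfl

theorem mem_relation_left_var {x : Symb Q} {p : WordPair (Symb Q)} :
    p ∈ (relation (left (var x))).down ↔ p = (FreeMonoid.of x, 1) := Iff.rfl

theorem mem_relation_right_var {x : Symb Q} {p : WordPair (Symb Q)} :
    p ∈ (relation (right (var x))).down ↔ p = (1, FreeMonoid.of x) := Iff.rfl

theorem ofList_replicate (x : Symb Q) (n : ℕ) :
    FreeMonoid.ofList (List.replicate n x) = FreeMonoid.of x ^ n := by
  induction n with
  | zero => rfl
  | succ n ih => rw [List.replicate_succ, FreeMonoid.ofList_cons, ih, pow_succ']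

theorem mem_relation_diag_star {x : Symb Q} {p : WordPair (Symb Q)} :
    p ∈ (relation (diag ((var x)∗))).down ↔
      ∃ n : ℕ, (FreeMonoid.of x ^ n, FreeMonoid.of x ^ n) = p := by
  rw [Hom.map_kstar, Hom.map_kstar, diag_var, map_mul, relation_left_var, relation_right_var,
    ← Set.up_mul, Set.singleton_mul_singleton, SetSemiring.mem_star_singleton]
  simp

/-- Provable inequalities hold in the model, where the order is inclusion and the left-hand side is
a single pair. -/
theorem mem_relation_of_step {e : Free (Symb Q ⊕ Symb Q)} {s s' : List (Symb Q)}
    (h : Step e s s') : (FreeMonoid.ofList s, FreeMonoid.ofList s') ∈ (relation e).down := by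
  have h' := Hom.monotone relation h
  rw [map_mul, relation_left_word, relation_right_word, ← Set.up_mul,
    Set.singleton_mul_singleton] at h'
  exact h' (by simp; rfl)

end Free

namespace Machine

open Free

variable {Q : Type u}

theorem ofList_config (n m : ℕ) (q : Q) : FreeMonoid.ofList (config n m q) =
    FreeMonoid.of .a ^ n * (FreeMonoid.of .b ^ m * FreeMonoid.of (.state q)) := by
  rw [config, FreeMonoid.ofList_append, FreeMonoid.ofList_append, ofList_replicate,
    ofList_replicate, FreeMonoid.ofList_singleton]

/-- The exponents of the stars occurring in the instruction determine the counters. The halting term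
has no star, which forces both counters to be zero. -/
theorem exists_next_of_mem_relation {i : Instr Q} {q : Q} {p : WordPair (Symb Q)}
    (h : p ∈ (relation (instrTerm i * left (var (.state q)))).down) :
    ∃ n m s', next i n m = some s' ∧
      p = (FreeMonoid.ofList (config n m q), FreeMonoid.ofList s') := by
  match i with
  | .inc .one q' =>
    simp only [instrTerm, map_mul, SetSemiring.mem_mul, mem_relation_left_var,
      mem_relation_right_var, mem_relation_diag_star] at h
    obtain ⟨_, ⟨_, ⟨_, ⟨_, rfl, _, ⟨n, rfl⟩, rfl⟩, _, ⟨m, rfl⟩, rfl⟩, _, rfl, rfl⟩, _, rfl, rfl⟩ := h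
    exact ⟨n, m, _, rfl, by simp [ofList_config, pow_succ', mul_assoc]⟩
  | .inc .two q' =>
    simp only [instrTerm, map_mul, SetSemiring.mem_mul, mem_relation_left_var,
      mem_relation_right_var, mem_relation_diag_star] at h
    obtain ⟨_, ⟨_, ⟨_, ⟨_, ⟨n, rfl⟩, _, rfl, rfl⟩, _, ⟨m, rfl⟩, rfl⟩, _, rfl, rfl⟩, _, rfl, rfl⟩ := h
    exact ⟨n, m, _, rfl, by simp [ofList_config, pow_succ', mul_assoc]⟩
  | .ite .one q₁ q₂ =>
    simp only [instrTerm, add_mul, map_add, SetSemiring.down_add, Set.mem_union, map_mul,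
      SetSemiring.mem_mul, mem_relation_left_var, mem_relation_right_var,
      mem_relation_diag_star] at h
    obtain ⟨_, ⟨_, ⟨m, rfl⟩, _, rfl, rfl⟩, _, rfl, rfl⟩ |
      ⟨_, ⟨_, ⟨_, ⟨_, rfl, _, ⟨n, rfl⟩, rfl⟩, _, ⟨m, rfl⟩, rfl⟩, _, rfl, rfl⟩, _, rfl, rfl⟩ := h
    · exact ⟨0, m, _, rfl, by simp [ofList_config]⟩
    · exact ⟨n + 1, m, _, rfl, by simp [ofList_config, pow_succ', mul_assoc]⟩
  | .ite .two q₁ q₂ =>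
    simp only [instrTerm, add_mul, map_add, SetSemiring.down_add, Set.mem_union, map_mul,
      SetSemiring.mem_mul, mem_relation_left_var, mem_relation_right_var,
      mem_relation_diag_star] at h
    obtain ⟨_, ⟨_, ⟨n, rfl⟩, _, rfl, rfl⟩, _, rfl, rfl⟩ |
      ⟨_, ⟨_, ⟨_, ⟨_, ⟨n, rfl⟩, _, rfl, rfl⟩, _, ⟨m, rfl⟩, rfl⟩, _, rfl, rfl⟩, _, rfl, rfl⟩ := h
    · exact ⟨n, 0, _, rfl, by simp [ofList_config]⟩
    · exact ⟨n, m + 1, _, rfl, by simp [ofList_config, pow_succ', mul_assoc]⟩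
  | .halt x =>
    simp only [instrTerm, map_mul, SetSemiring.mem_mul, mem_relation_left_var,
      mem_relation_right_var] at h
    obtain ⟨_, rfl, _, rfl, rfl⟩ := h
    exact ⟨0, 0, _, rfl, by simp [ofList_config]⟩

theorem exists_next_of_step [Fintype Q] {M : Machine Q} {s s' : List (Symb Q)}
    (h : Step M.transition s s') :
    ∃ n m q, s = config n m q ∧ next (M.trans q) n m = some s' := by
  have key : relation M.transition ≤ Set.up {p | ∃ n m q s', next (M.trans q) n m = some s' ∧
      p = (FreeMonoid.ofList (config n m q), FreeMonoid.ofList s')} := by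
    rw [transition, map_sum]
    refine sum_le_of_forall_le fun q _ p hp => ?_
    obtain ⟨n, m, s', hs, rfl⟩ := exists_next_of_mem_relation hp
    exact ⟨n, m, q, s', hs, rfl⟩
  obtain ⟨n, m, q, t, ht, he⟩ := key (mem_relation_of_step h)
  obtain ⟨h₁, h₂⟩ := Prod.ext_iff.1 he
  -- Elements of `FreeMonoid` are lists by definition, so equalities there are equalities of words.
  exact ⟨n, m, q, h₁, ht.trans (congrArg some (h₂ : s' = t).symm)⟩

theorem right_word_mul_star_le_of_reflTransGen [Fintype Q] [DecidableEq Q] (M : Machine Q)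
    {s : List (Symb Q)} (h : Relation.ReflTransGen (Step M.transition) s [.c 1]) :
    right (word s) * M.transition∗ ≤
      sigmaStar Q * right (running Q + var (.c 1)) + mismatch Q * M.transition∗ := by
  induction h using Relation.ReflTransGen.head_induction_on with
  | refl => exact right_word_c_mul_star_le M
  | head hs _ ih =>
    obtain ⟨n, m, q, rfl, hn⟩ := exists_next_of_step hs
    exact right_word_mul_star_le M hn ih

end Machine

/-! ### The code of the residual as a primitive recursive function. -/

namespace TermCode

/-- Code of the sum of two syntax trees. -/
def add (x y : ℕ) : ℕ := Nat.pair 2 (Nat.pair x y)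

/-- Code of the product of two syntax trees. -/
def mul (x y : ℕ) : ℕ := Nat.pair 3 (Nat.pair x y)

/-- Code of the star of a syntax tree. -/
def star (x : ℕ) : ℕ := Nat.pair 4 x

/-- Code of a left symbol. -/
def varL (k : ℕ) : ℕ := Nat.pair 1 (Nat.pair 0 k)

/-- Code of a right symbol. -/
def varR (k : ℕ) : ℕ := Nat.pair 1 (Nat.pair 1 k)

/-- Code of the sum of a list of syntax trees. -/
def sum (l : List ℕ) : ℕ := l.foldr add (Nat.pair 0 0)

/-- Code of the star of a symbol, viewed as a term over two copies of the symbols. -/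
def diagStar (k : ℕ) : ℕ := star (mul (varL k) (varR k))

/-- Code of the term of an instruction, given the code of the instruction. -/
def instr (c : ℕ) : ℕ :=
  if c.unpair.1 = 0 then
    if c.unpair.2.unpair.1 = 1 then
      mul (mul (mul (varR 0) (diagStar 0)) (diagStar 1)) (varR (4 + c.unpair.2.unpair.2))
    else
      mul (mul (mul (diagStar 0) (varR 1)) (diagStar 1)) (varR (4 + c.unpair.2.unpair.2))
  else if c.unpair.1 = 1 then
    if c.unpair.2.unpair.1 = 1 then
      add (mul (diagStar 1) (varR (4 + c.unpair.2.unpair.2.unpair.1)))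
        (mul (mul (mul (varL 0) (diagStar 0)) (diagStar 1))
          (varR (4 + c.unpair.2.unpair.2.unpair.2)))
    else
      add (mul (diagStar 0) (varR (4 + c.unpair.2.unpair.2.unpair.1)))
        (mul (mul (mul (diagStar 0) (varL 1)) (diagStar 1))
          (varR (4 + c.unpair.2.unpair.2.unpair.2)))
  else varR (2 + c.unpair.2)

/-- Code of the transition term, given the list of the codes of the instructions. -/
def transition (l : List ℕ) : ℕ :=
  sum ((List.range l.length).map fun k => mul (instr (l.getD k 0)) (varL (4 + k)))

/-- Code of the left copy of `Σ_M*`, given the number of states. -/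
def allL (n : ℕ) : ℕ := star (sum ((List.range (4 + n)).map varL))

/-- Code of the right copy of `Σ_M*`, given the number of states. -/
def allR (n : ℕ) : ℕ := star (sum ((List.range (4 + n)).map varR))

/-- Code of the residual of a machine, given the list of the codes of its instructions. -/
def residual (l : List ℕ) : ℕ :=
  mul (mul (allR l.length) (mul (diagStar 0) (mul (allL l.length) (mul (allR l.length)
    (mul (diagStar 1) (mul (allR l.length) (allL l.length)))))))
    (star (transition l))

section Primrec

variable {α : Type*} [Primcodable α]

theorem primrec_add {f g : α → ℕ} (hf : Primrec f) (hg : Primrec g) :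
    Primrec fun x => add (f x) (g x) :=
  Primrec₂.natPair.comp (Primrec.const 2) (Primrec₂.natPair.comp hf hg)

theorem primrec_mul {f g : α → ℕ} (hf : Primrec f) (hg : Primrec g) :
    Primrec fun x => mul (f x) (g x) :=
  Primrec₂.natPair.comp (Primrec.const 3) (Primrec₂.natPair.comp hf hg)

theorem primrec_star {f : α → ℕ} (hf : Primrec f) : Primrec fun x => star (f x) :=
  Primrec₂.natPair.comp (Primrec.const 4) hf

theorem primrec_varL {f : α → ℕ} (hf : Primrec f) : Primrec fun x => varL (f x) :=
  Primrec₂.natPair.comp (Primrec.const 1) (Primrec₂.natPair.comp (Primrec.const 0) hf)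

theorem primrec_varR {f : α → ℕ} (hf : Primrec f) : Primrec fun x => varR (f x) :=
  Primrec₂.natPair.comp (Primrec.const 1) (Primrec₂.natPair.comp (Primrec.const 1) hf)

theorem primrec_sum {f : α → List ℕ} (hf : Primrec f) : Primrec fun x => sum (f x) :=
  Primrec.list_foldr hf (Primrec.const _)
    (primrec_add (Primrec.fst.comp Primrec.snd) (Primrec.snd.comp Primrec.snd)).to₂

theorem primrec_const_add (k : ℕ) {f : α → ℕ} (hf : Primrec f) : Primrec fun x => k + f x :=
  Primrec.nat_add.comp (Primrec.const k) hf

theorem primrec_unpair_fst {f : α → ℕ} (hf : Primrec f) : Primrec fun x => (f x).unpair.1 :=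
  Primrec.fst.comp (Primrec.unpair.comp hf)

theorem primrec_unpair_snd {f : α → ℕ} (hf : Primrec f) : Primrec fun x => (f x).unpair.2 :=
  Primrec.snd.comp (Primrec.unpair.comp hf)

theorem primrecPred_eq_const {f : α → ℕ} (hf : Primrec f) (k : ℕ) :
    PrimrecPred fun x => f x = k :=
  Primrec.eq.comp hf (Primrec.const k)

theorem primrec_instr : Primrec instr := by
  have h₁ : Primrec fun c : ℕ => c.unpair.1 := primrec_unpair_fst Primrec.id
  have h₂ : Primrec fun c : ℕ => c.unpair.2 := primrec_unpair_snd Primrec.id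
  have h₃ := primrec_unpair_fst h₂
  have h₄ := primrec_unpair_snd h₂
  have h₅ := primrec_varR (primrec_const_add 4 (primrec_unpair_fst h₄))
  have h₆ := primrec_varR (primrec_const_add 4 (primrec_unpair_snd h₄))
  refine Primrec.ite (primrecPred_eq_const h₁ 0)
    (Primrec.ite (primrecPred_eq_const h₃ 1) ?_ ?_)
    (Primrec.ite (primrecPred_eq_const h₁ 1)
      (Primrec.ite (primrecPred_eq_const h₃ 1) ?_ ?_) ?_)
  · exact primrec_mul (Primrec.const _) (primrec_varR (primrec_const_add 4 h₄))
  · exact primrec_mul (Primrec.const _) (primrec_varR (primrec_const_add 4 h₄))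
  · exact primrec_add (primrec_mul (Primrec.const _) h₅) (primrec_mul (Primrec.const _) h₆)
  · exact primrec_add (primrec_mul (Primrec.const _) h₅) (primrec_mul (Primrec.const _) h₆)
  · exact primrec_varR (primrec_const_add 2 h₂)

theorem primrec_transition : Primrec transition := by
  refine primrec_sum (Primrec.list_map (Primrec.list_range.comp Primrec.list_length) ?_)
  exact primrec_mul
    (primrec_instr.comp ((Primrec.list_getD 0).comp Primrec.fst Primrec.snd))
    (primrec_varL (primrec_const_add 4 Primrec.snd))

theorem primrec_allL : Primrec allL :=
  primrec_star (primrec_sum (Primrec.list_map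
    (Primrec.list_range.comp (primrec_const_add 4 Primrec.id)) (primrec_varL Primrec.snd)))

theorem primrec_allR : Primrec allR :=
  primrec_star (primrec_sum (Primrec.list_map
    (Primrec.list_range.comp (primrec_const_add 4 Primrec.id)) (primrec_varR Primrec.snd)))

theorem primrec_residual : Primrec residual := by
  have hL := primrec_allL.comp (Primrec.list_length (α := ℕ))
  have hR := primrec_allR.comp (Primrec.list_length (α := ℕ))
  exact primrec_mul (primrec_mul hR (primrec_mul (Primrec.const _) (primrec_mul hL
    (primrec_mul hR (primrec_mul (Primrec.const _) (primrec_mul hR hL))))))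
    (primrec_star primrec_transition)

end Primrec

end TermCode

/-! ### Syntax trees denoting the residual, and agreement with their codes. -/

namespace KTerm

variable {X : Type u}

/-- The sum of a list of syntax trees. -/
def sum (l : List (KTerm X)) : KTerm X := l.foldr add zero

theorem code_sum (c : X → ℕ) (l : List (KTerm X)) :
    (sum l).code c = TermCode.sum (l.map (code c)) := by
  induction l with
  | nil => rfl
  | cons t l ih => exact congrArg (TermCode.add (t.code c)) ih

theorem mk_sum [Commutable X] (l : List (KTerm X)) :
    Free.mk (sum l) = (l.map Free.mk).sum := by
  induction l with
  | nil => rfl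
  | cons t l ih =>
    rw [List.map_cons, List.sum_cons, ← ih]
    rfl

end KTerm

namespace Machine

open Free

variable {Q : Type u} {n : ℕ}

/-- The symbols in the order of their codes. -/
def symbols (e : Q ≃ Fin n) : List (Symb Q) :=
  [.a, .b, .c 0, .c 1] ++ List.ofFn fun i => .state (e.symm i)

/-- The codes fill an initial segment of the natural numbers, so the sums over all symbols can be
coded from the number of states alone. -/
theorem map_code_symbols (e : Q ≃ Fin n) :
    (symbols e).map (Symb.code fun q => e q) = List.range (4 + n) := by
  rw [symbols, List.map_append, List.range_add, List.map_ofFn]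
  congr 1
  apply List.ext_getElem
  · simp
  · intro i _ _
    simp [Symb.code]

theorem sum_map_symbols [Fintype Q] (e : Q ≃ Fin n) {A : Type*} [AddCommMonoid A]
    (f : Symb Q → A) : ((symbols e).map f).sum = ∑ x, f x := by
  classical
  -- The codes of the listed symbols are pairwise distinct, hence so are the symbols.
  have hnd : (symbols e).Nodup := by
    refine List.Nodup.of_map (Symb.code fun q => (e q : ℕ)) ?_
    rw [map_code_symbols]
    exact List.nodup_range
  rw [← List.sum_toFinset f hnd]
  congr 1
  rw [Finset.eq_univ_iff_forall]
  intro x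
  rw [List.mem_toFinset, symbols, List.mem_append, List.mem_ofFn]
  match x with
  | .a => simp
  | .b => simp
  | .c 0 => simp
  | .c 1 => simp
  | .state q => exact Or.inr ⟨e q, by simp⟩

/-- A syntax tree of the star of a symbol, viewed as a term over two copies of the symbols. -/
def diagStarTree (x : Symb Q) : KTerm (Symb Q ⊕ Symb Q) :=
  .star (.mul (.var (.inl x)) (.var (.inr x)))

/-- A syntax tree of an instruction. -/
def instrTree : Instr Q → KTerm (Symb Q ⊕ Symb Q)
  | .inc .one q => .mul (.mul (.mul (.var (.inr .a)) (diagStarTree .a)) (diagStarTree .b))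
      (.var (.inr (.state q)))
  | .inc .two q => .mul (.mul (.mul (diagStarTree .a) (.var (.inr .b))) (diagStarTree .b))
      (.var (.inr (.state q)))
  | .ite .one q₁ q₂ => .add (.mul (diagStarTree .b) (.var (.inr (.state q₁))))
      (.mul (.mul (.mul (.var (.inl .a)) (diagStarTree .a)) (diagStarTree .b))
        (.var (.inr (.state q₂))))
  | .ite .two q₁ q₂ => .add (.mul (diagStarTree .a) (.var (.inr (.state q₁))))
      (.mul (.mul (.mul (diagStarTree .a) (.var (.inl .b))) (diagStarTree .b))
        (.var (.inr (.state q₂))))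
  | .halt x => .var (.inr (.c x))

theorem mk_instrTree (i : Instr Q) : Free.mk (instrTree i) = instrTerm i := by
  match i with
  | .inc .one q => rfl
  | .inc .two q => rfl
  | .ite .one q₁ q₂ => rfl
  | .ite .two q₁ q₂ => rfl
  | .halt x => rfl

theorem termCode_instrTree (e : Q ≃ Fin n) (i : Instr Q) :
    termCode e (instrTree i) = TermCode.instr (i.code fun q => e q) := by
  match i with
  | .inc .one q => simp [TermCode.instr, Instr.code, Counter.code]; rfl
  | .inc .two q => simp [TermCode.instr, Instr.code, Counter.code]; rfl
  | .ite .one q₁ q₂ => simp [TermCode.instr, Instr.code, Counter.code]; rfl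
  | .ite .two q₁ q₂ => simp [TermCode.instr, Instr.code, Counter.code]; rfl
  | .halt x => simp [TermCode.instr, Instr.code]; rfl

/-- A syntax tree of the transition relation. -/
def transitionTree (e : Q ≃ Fin n) (M : Machine Q) : KTerm (Symb Q ⊕ Symb Q) :=
  .sum (List.ofFn fun i => .mul (instrTree (M.trans (e.symm i))) (.var (.inl (.state (e.symm i)))))

theorem mk_transitionTree [Fintype Q] (e : Q ≃ Fin n) (M : Machine Q) :
    Free.mk (transitionTree e M) = M.transition := by
  rw [transitionTree, KTerm.mk_sum, List.map_ofFn, List.sum_ofFn, transition,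
    ← Equiv.sum_comp e.symm]
  refine Finset.sum_congr rfl fun i _ => ?_
  rw [← mk_instrTree]
  rfl

theorem termCode_transitionTree (e : Q ≃ Fin n) (M : Machine Q) :
    termCode e (transitionTree e M) = TermCode.transition (M.code e).2 := by
  rw [transitionTree, termCode, KTerm.code_sum, TermCode.transition]
  congr 1
  apply List.ext_getElem
  · simp [Machine.code]
  · intro i h₁ h₂
    -- The index is within the list of instructions, so the default `0` of `getD` in
    -- `TermCode.transition` is never returned.
    have hi : i < n := by simpa using h₁
    have := termCode_instrTree e (M.trans (e.symm ⟨i, hi⟩))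
    simp only [List.map_ofFn, List.getElem_ofFn, List.getElem_map, List.getElem_range,
      Machine.code, List.getD_eq_getElem?_getD, List.getElem?_ofFn, hi, dif_pos,
      Option.getD_some, ← this]
    simp [termCode, KTerm.code, TermCode.mul, TermCode.varL, sumCode, Symb.code]

/-- A syntax tree of the left copy of `Σ_M*`. -/
def leftWordsTree (e : Q ≃ Fin n) : KTerm (Symb Q ⊕ Symb Q) :=
  .star (.sum ((symbols e).map fun x => .var (.inl x)))

/-- A syntax tree of the right copy of `Σ_M*`. -/
def rightWordsTree (e : Q ≃ Fin n) : KTerm (Symb Q ⊕ Symb Q) :=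
  .star (.sum ((symbols e).map fun x => .var (.inr x)))

theorem mk_leftWordsTree [Fintype Q] (e : Q ≃ Fin n) :
    Free.mk (leftWordsTree e) = left (allWords Q) := by
  rw [allWords, Hom.map_kstar, map_sum, ← sum_map_symbols e]
  change (Free.mk (.sum _))∗ = _
  rw [KTerm.mk_sum, List.map_map]
  rfl

theorem mk_rightWordsTree [Fintype Q] (e : Q ≃ Fin n) :
    Free.mk (rightWordsTree e) = right (allWords Q) := by
  rw [allWords, Hom.map_kstar, map_sum, ← sum_map_symbols e]
  change (Free.mk (.sum _))∗ = _
  rw [KTerm.mk_sum, List.map_map]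
  rfl

theorem termCode_leftWordsTree (e : Q ≃ Fin n) :
    termCode e (leftWordsTree e) = TermCode.allL n := by
  change TermCode.star (KTerm.code _ (.sum _)) = _
  rw [KTerm.code_sum, TermCode.allL, ← map_code_symbols e, List.map_map, List.map_map]
  rfl

theorem termCode_rightWordsTree (e : Q ≃ Fin n) :
    termCode e (rightWordsTree e) = TermCode.allR n := by
  change TermCode.star (KTerm.code _ (.sum _)) = _
  rw [KTerm.code_sum, TermCode.allR, ← map_code_symbols e, List.map_map, List.map_map]
  rfl

/-- A syntax tree of the residual that follows a mismatch. -/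
def residualTree (e : Q ≃ Fin n) (M : Machine Q) : KTerm (Symb Q ⊕ Symb Q) :=
  .mul (.mul (rightWordsTree e) (.mul (diagStarTree .a) (.mul (leftWordsTree e)
    (.mul (rightWordsTree e) (.mul (diagStarTree .b)
      (.mul (rightWordsTree e) (leftWordsTree e)))))))
    (.star (transitionTree e M))

theorem mk_residualTree [Fintype Q] (e : Q ≃ Fin n) (M : Machine Q) :
    Free.mk (residualTree e M) = right (allWords Q) * tail Q * M.transition∗ := by
  rw [tail, ← mk_leftWordsTree e, ← mk_rightWordsTree e, ← mk_transitionTree e M]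
  rfl

theorem termCode_residualTree (e : Q ≃ Fin n) (M : Machine Q) :
    termCode e (residualTree e M) = TermCode.residual (M.code e).2 := by
  have hn : (M.code e).2.length = n := by simp [Machine.code]
  rw [TermCode.residual, hn, ← termCode_leftWordsTree e, ← termCode_rightWordsTree e,
    ← termCode_transitionTree e M]
  rfl

end Machine

end PreKA

/-- Completeness: a term `ρ` is computable from a two-counter machine `M` and a configuration `s`
such that, if `s` reaches `c₁`, then the inequality between `s_r R_M*` and
`Σ_M* (C_M + c₁)_r + Σ_M* Σ_M^≠ ρ` holds in the free pre-Kleene algebra. Computability is that of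
a single total function `F` on codes, whatever the numbering of the control states. -/
theorem mainTheorem3 :
    ∃ F : (ℕ × List ℕ) × List ℕ → ℕ, Computable F ∧
      ∀ (Q : Type*) [Fintype Q] [DecidableEq Q] (e : Q ≃ Fin (Fintype.card Q))
        (M : PreKA.Machine Q) (s : List (PreKA.Symb Q)),
        PreKA.Free.word s ≤ PreKA.Machine.configs Q →
        ∃ ρ : PreKA.KTerm (PreKA.Symb Q ⊕ PreKA.Symb Q),
          PreKA.Machine.termCode e ρ = F (M.code e, PreKA.Machine.wordCode e s) ∧
          (Relation.ReflTransGen (PreKA.Free.Step M.transition) s [.c 1] →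
            PreKA.Free.right (PreKA.Free.word s) * M.transition∗ ≤
              PreKA.Machine.sigmaStar Q *
                  PreKA.Free.right (PreKA.Machine.running Q + PreKA.Free.var (.c 1)) +
                PreKA.Machine.sigmaStar Q * PreKA.Machine.sigmaNe Q * PreKA.Free.mk ρ) := by
  -- The residual is built from the list of instructions alone, so one term serves every `s`. Its
  -- code is primitive recursive, hence computable.
  refine ⟨fun p => PreKA.TermCode.residual p.1.2, (PreKA.TermCode.primrec_residual.comp
    (Primrec.snd.comp Primrec.fst)).to_comp, fun Q _ _ e M s _ =>
      ⟨M.residualTree e, M.termCode_residualTree e, fun h => ?_⟩⟩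
  rw [PreKA.Machine.mk_residualTree, ← mul_assoc]
  exact M.right_word_mul_star_le_of_reflTransGen h
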